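/- Let $H$ be a complex Hilbert space, and let $A,B$ be bounded operators on $H$ with $$0<m_2I\le A\le m_1I<M_1I\le B\le M_2I,$$ where $m_2\le m_1<M_1\le M_2$ are positive real numbers. Let $v\ge 1$, and let $\|\cdot\|$ be a unitarily invariant norm on $\mathcal B(H)$, that is, a norm with $\|UXV\|=\|X\|$ for all $X\in\mathcal B(H)$ and all unitaries $U,V$. For positive invertible operators $X,Y$ put $$X\,\sharp_v\,Y=X^{1/2}\left(X^{-1/2}YX^{-1/2}\right)^vX^{1/2},$$ for positive reals $a,b$ put $a\,\sharp_v\,b=a^{1-v}b^v$, and for operators or real numbers put $X\nabla_vY=(1-v)X+vY$. (1) (Ando--Hiai inequality) Suppose that the norm is normalized so that $\|P\|\ge 1$ for every orthogonal projection $P$ of rank one (for instance $\|P\|=1$). Then for every $p>1$ $$\|A^p\,\sharp_v\,B^p\|\le C_p\,\|A\,\sharp_v\,B\|^p,\qquad C_p=\frac{m_2^p\,\sharp_v\,M_2^p}{m_2^p\,\nabla_v\,M_2^p},$$ and in particular $\|A\,\sharp_v\,B\|\le 1$ implies $\|A^p\,\sharp_v\,B^p\|\le C_p$. (2) (Golden--Thompson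 inequality) Suppose that $H$ is finite-dimensional, so that $A$ and $B$ are matrices. Then for every $p>0$ $$\left\|\left(e^{pA}\,\sharp_v\,e^{pB}\right)^{1/p}\right\|\le\gamma_p^{1/p}\,\left\|e^{A\nabla_vB}\right\|,\qquad \gamma_p=\frac{e^{pm_2}\,\sharp_v\,e^{pM_2}}{e^{pm_2}\,\nabla_v\,e^{pM_2}}.$$ -/

import Mathlib

noncomputable section

/-- The weighted arithmetic mean `a ∇_v b = (1 - v) a + v b`, for scalars and for operators;
the weight `v` may be any real number. -/
def arithMean {E : Type*} [AddCommGroup E] [Module ℝ E] (v : ℝ) (a b : E) : E :=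
  (1 - v) • a + v • b

/-- The weighted geometric mean `a ♯_v b = a ^ (1 - v) * b ^ v` of two positive reals;
the weight `v` may be any real number. -/
def scalarGeomMean (v a b : ℝ) : ℝ :=
  a ^ (1 - v) * b ^ v

variable {H : Type*} [NormedAddCommGroup H] [InnerProductSpace ℂ H] [CompleteSpace H]

/-- The weighted geometric mean
`A ♯_v B = A ^ (1/2) (A ^ (-1/2) B A ^ (-1/2)) ^ v A ^ (1/2)` of two positive invertible operators;
real powers are those of the continuous functional calculus, and the weight `v` may be any real
number. -/
def opGeomMean (v : ℝ) (A B : H →L[ℂ] H) : H →L[ℂ] H :=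
  A ^ (1 / 2 : ℝ) * (A ^ (-(1 / 2) : ℝ) * B * A ^ (-(1 / 2) : ℝ)) ^ v * A ^ (1 / 2 : ℝ)

/-- A seminorm `N` on the space of bounded operators on `H` is a unitarily invariant norm if it is
definite and `N (U X V) = N X` for all operators `X` and all unitaries `U`, `V`. -/
structure IsUnitarilyInvariantNorm (N : Seminorm ℂ (H →L[ℂ] H)) : Prop where
  eq_zero_of_map_eq_zero : ∀ X : H →L[ℂ] H, N X = 0 → X = 0
  map_unitary_mul_mul : ∀ U ∈ unitary (H →L[ℂ] H), ∀ V ∈ unitary (H →L[ℂ] H),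
    ∀ X : H →L[ℂ] H, N (U * X * V) = N X

end

/-!
The norm `N` is only assumed to be unitarily invariant, and everything below happens in a unital
C⋆-algebra `𝔄`, except for one estimate that uses projections of rank one.

*Monotonicity of `N`.* A self-adjoint contraction is the average of a unitary and its adjoint, so
by polar decomposition `N (W X W⋆) ≤ N X` for every invertible contraction `W`. If `0 < S ≤ T`,
then `S = W T W⋆` for the contraction `W = S ^ (1/2) T ^ (-1/2)`; hence `N S ≤ N T`. The relation
`S ≤ W T W⋆` for some invertible contraction `W` (`ContractiveLE`) survives squaring
(`ContractiveLE.sq`), which makes `N (exp L) ≤ N (exp Z)` for `L ≤ Z` (`map_exp_le_map_exp`), as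
`exp L` is a `2 ^ k`-th power of an element close to `1 + L / 2 ^ k`.

*Comparison of the means.* If `A ≤ B` and `1 ≤ v`, the functional calculus turns Bernoulli's
inequality and its reverse into `A ∇_v B ≤ A ♯_v B ≤ C • (A ∇_v B)`
(`arithMean_le_cstarGeomMean`, `cstarGeomMean_le_smul_arithMean`), where `C` is the quotient of the
scalar means of the extreme spectral bounds.

*Operator concavity.* Since `B` is the convex combination of `A` and `A ∇_v B` with weights
`1 - 1 / v` and `1 / v`, an operator concave `g` satisfies `g (A ∇_v B) ≤ g A ∇_v g B`
(`le_arithMean_of_concaveOn`). The separation of the spectra of `A` and `B` gives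
`A ^ p ≤ B ^ p` and `exp (p A) ≤ exp (p B)` although neither function is operator monotone, so this
applies to these pairs. With `g = (· ^ (1 / p))` the element `X = A ^ p ∇_v B ^ p` has
`X ^ (1 / p) ≤ A ∇_v B ≤ A ♯_v B`, and the Ando-Hiai inequality follows from `N (S ^ p) ≤ N S ^ p`
(`map_rpow_le`), which uses the normalization of `N` on projections of rank one. With `g = log`,
the operator monotonicity of the logarithm yields
`(1 / p) log (exp (p A) ♯_v exp (p B)) ≤ (1 / p) log C + A ∇_v B`, and the Golden-Thompson
inequality follows from the monotonicity of `N ∘ exp`.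
-/

/-! ### Bernoulli's inequality and scalar means -/

section Scalar

/-- Bernoulli's inequality: for `1 ≤ v` the weighted arithmetic mean of `1` and `x` is at most the
geometric one, opposite to the case of weights in `[0, 1]`. -/
theorem one_sub_add_mul_le_rpow {v x : ℝ} (hv : 1 ≤ v) (hx : 0 ≤ x) :
    1 - v + v * x ≤ x ^ v := by
  have h := one_add_mul_self_le_rpow_one_add (s := x - 1) (by linarith) hv
  rw [add_sub_cancel] at h
  linarith

/-- The quotient `x ^ v / (1 - v + v * x)` of the weighted geometric and arithmetic means of `1` and
`x` increases on `[1, ∞)`. -/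
theorem rpow_mul_le_rpow_mul {v x h : ℝ} (hv : 1 ≤ v) (hx : 1 ≤ x) (hxh : x ≤ h) :
    x ^ v * (1 - v + v * h) ≤ h ^ v * (1 - v + v * x) := by
  have hx0 : 0 < x := by linarith
  obtain ⟨r, rfl⟩ : ∃ r, h = x * r := ⟨h / x, by field_simp⟩
  have hr : 1 ≤ r := by
    by_contra! hr
    nlinarith
  have h1 := one_sub_add_mul_le_rpow hv (by linarith : 0 ≤ r)
  have h2 : 0 ≤ 1 - v + v * x := by nlinarith
  -- the difference of the two sides is `v * (v - 1) * (x - 1) * (r - 1)`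
  have h3 : 1 - v + v * (x * r) ≤ (1 - v + v * x) * (1 - v + v * r) := by
    have h4 := mul_nonneg (mul_nonneg (by linarith : 0 ≤ v) (sub_nonneg.2 hv))
      (mul_nonneg (sub_nonneg.2 hx) (sub_nonneg.2 hr))
    linarith
  rw [Real.mul_rpow hx0.le (by linarith), mul_assoc]
  gcongr
  calc _ ≤ (1 - v + v * x) * (1 - v + v * r) := h3
    _ ≤ (1 - v + v * x) * r ^ v := by gcongr
    _ = _ := mul_comm _ _

/-- Both means are homogeneous, so their quotient depends only on `b / a`. -/
theorem scalarGeomMean_div_arithMean {v a b : ℝ} (ha : 0 < a) (hb : 0 < b) :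
    scalarGeomMean v a b / arithMean v a b = (b / a) ^ v / (1 - v + v * (b / a)) := by
  have h : a * (1 - v + v * (b / a)) = arithMean v a b := by
    simp only [arithMean, smul_eq_mul]
    field_simp
  rw [← h, scalarGeomMean, Real.rpow_sub ha, Real.rpow_one, Real.div_rpow hb.le ha.le]
  field_simp

theorem arithMean_pos {v a b : ℝ} (hv : 1 ≤ v) (ha : 0 < a) (hab : a ≤ b) :
    0 < arithMean v a b := by
  simp only [arithMean, smul_eq_mul]
  nlinarith

theorem scalarGeomMean_div_arithMean_pos {v a b : ℝ} (hv : 1 ≤ v) (ha : 0 < a) (hab : a ≤ b) :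
    0 < scalarGeomMean v a b / arithMean v a b :=
  div_pos (mul_pos (Real.rpow_pos_of_pos ha _) (Real.rpow_pos_of_pos (ha.trans_le hab) _))
    (arithMean_pos hv ha hab)

end Scalar

/-! ### Unitarily invariant seminorms on a C⋆-algebra -/

section Seminorm

variable {𝔄 : Type*} [CStarAlgebra 𝔄]

theorem exp_add_smul_one (Z : 𝔄) (c : ℝ) :
    NormedSpace.exp (Z + c • (1 : 𝔄)) = Real.exp c • NormedSpace.exp Z := by
  let _ : NormedAlgebra ℚ 𝔄 := .restrictScalars ℚ ℝ 𝔄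
  rw [NormedSpace.exp_add_of_commute ((Commute.one_right Z).smul_right c),
    ← Algebra.algebraMap_eq_smul_one, ← NormedSpace.algebraMap_exp_comm, ← Real.exp_eq_exp_ℝ,
    ← Algebra.commutes, ← Algebra.smul_def]

theorem map_real_smul_of_nonneg (N : Seminorm ℂ 𝔄) {c : ℝ} (hc : 0 ≤ c) (X : 𝔄) :
    N (c • X) = c * N X := by
  rw [← Complex.coe_smul, map_smul_eq_mul, Complex.norm_of_nonneg hc]
variable [PartialOrder 𝔄] [StarOrderedRing 𝔄] {N : Seminorm ℂ 𝔄}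

/-- A self-adjoint contraction `K` is the average of the unitaries `K ± i √(1 - K²)`. -/
theorem map_conj_le_of_isSelfAdjoint
    (hN : ∀ U ∈ unitary 𝔄, ∀ V ∈ unitary 𝔄, ∀ X, N (U * X * V) = N X)
    {K : 𝔄} (hK : IsSelfAdjoint K) (hK1 : ‖K‖ ≤ 1) (X : 𝔄) : N (K * X * K) ≤ N X := by
  set U : 𝔄 := K + Complex.I • CFC.sqrt (1 - K ^ 2)
  have hU : U ∈ unitary 𝔄 := hK.self_add_I_smul_cfcSqrt_sub_sq_mem_unitary K hK1
  have hU' : star U ∈ unitary 𝔄 := Unitary.star_mem hU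
  have h1 : (2 : ℂ) • K = U + star U := by
    simp only [U, star_add, star_smul, hK.star_eq,
      (CFC.sqrt_nonneg (1 - K ^ 2)).isSelfAdjoint.star_eq, Complex.star_def, Complex.conj_I]
    module
  have h2 : (4 : ℂ) • (K * X * K) = (U * X * U + U * X * star U) +
      (star U * X * U + star U * X * star U) := by
    calc (4 : ℂ) • (K * X * K) = ((2 : ℂ) • K) * X * ((2 : ℂ) • K) := by
          rw [smul_mul_assoc, smul_mul_assoc, mul_smul_comm, smul_smul]
          norm_num
      _ = _ := by
          rw [h1]
          noncomm_ring
  have h3 : N ((4 : ℂ) • (K * X * K)) ≤ (N X + N X) + (N X + N X) := by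
    rw [h2]
    refine (map_add_le_add N _ _).trans (add_le_add ?_ ?_) <;>
    · refine (map_add_le_add N _ _).trans_eq ?_
      simp only [hN _ hU _ hU, hN _ hU _ hU', hN _ hU' _ hU, hN _ hU' _ hU']
  rw [map_smul_eq_mul] at h3
  norm_num at h3
  linarith

/-- By the polar decomposition of `W`, this reduces to the positive contraction `|W|`. -/
theorem map_conj_le_of_isUnit
    (hN : ∀ U ∈ unitary 𝔄, ∀ V ∈ unitary 𝔄, ∀ X, N (U * X * V) = N X)
    {W : 𝔄} (hW : IsUnit W) (hW1 : ‖W‖ ≤ 1) (X : 𝔄) : N (W * X * star W) ≤ N X := by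
  have hpos : IsStrictlyPositive (star W * W) :=
    (hW.star.mul hW).isStrictlyPositive (star_mul_self_nonneg W)
  set P := (star W * W) ^ (1 / 2 : ℝ)
  set Q := (star W * W) ^ (-(1 / 2) : ℝ)
  have hPsa : IsSelfAdjoint P := IsSelfAdjoint.of_nonneg CFC.rpow_nonneg
  have hQsa : star Q = Q := (IsSelfAdjoint.of_nonneg CFC.rpow_nonneg).star_eq
  have hQP : Q * P = 1 := CFC.rpow_neg_mul_rpow _
  have hP1 : ‖P‖ ≤ 1 := by
    have hle : star W * W ≤ 1 := by
      rw [← CStarAlgebra.norm_le_one_iff_of_nonneg _ hpos.nonneg, CStarRing.norm_star_mul_self]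
      nlinarith [norm_nonneg W]
    rw [CStarAlgebra.norm_le_one_iff_of_nonneg _ CFC.rpow_nonneg]
    simpa using CFC.rpow_le_rpow (p := 1 / 2) (by constructor <;> norm_num) hle
  have hU : W * Q ∈ unitary 𝔄 := by
    have h1 : star (W * Q) * (W * Q) = 1 := by
      rw [star_mul, hQsa, mul_assoc, ← mul_assoc (star W), ← mul_assoc]
      exact CFC.conjugate_rpow_neg_one_half _
    refine ⟨h1, ?_⟩
    have hu : IsUnit (W * Q) := hW.mul (hpos.isUnit.cfcRpow _ hpos.nonneg)
    calc (W * Q) * star (W * Q) = (W * Q) * star (W * Q) * ((W * Q) * ↑hu.unit⁻¹) := by simp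
      _ = (W * Q) * (star (W * Q) * (W * Q)) * ↑hu.unit⁻¹ := by simp only [mul_assoc]
      _ = 1 := by rw [h1]; simp
  have hWUP : W = W * Q * P := by rw [mul_assoc, hQP, mul_one]
  calc N (W * X * star W) = N (W * Q * (P * X * P) * star (W * Q)) := by
        nth_rw 1 2 [hWUP]
        rw [star_mul (W * Q), hPsa.star_eq]
        simp only [mul_assoc]
    _ = N (P * X * P) := hN _ hU _ (Unitary.star_mem hU) _
    _ ≤ N X := map_conj_le_of_isSelfAdjoint hN hPsa hP1 X

/-- The contraction is `W = S ^ (1/2) * T ^ (-1/2)`. -/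
theorem exists_isUnit_conj_eq_of_le {S T : 𝔄}
    (hS : IsStrictlyPositive S) (hST : S ≤ T) :
    ∃ W : 𝔄, IsUnit W ∧ ‖W‖ ≤ 1 ∧ W * T * star W = S := by
  have hT : IsStrictlyPositive T := hS.of_le hST
  refine ⟨CFC.sqrt S * T ^ (-(1 / 2) : ℝ), hS.isUnit_cfcSqrt.mul (hT.isUnit.cfcRpow _ hT.nonneg),
    (le_iff_norm_sqrt_mul_rpow S T hS.nonneg hT).1 hST, ?_⟩
  rw [star_mul, (IsSelfAdjoint.of_nonneg (CFC.sqrt_nonneg S)).star_eq,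
    (IsSelfAdjoint.of_nonneg (CFC.rpow_nonneg (a := T))).star_eq]
  calc _ = CFC.sqrt S * (T ^ (-(1 / 2) : ℝ) * T * T ^ (-(1 / 2) : ℝ)) * CFC.sqrt S := by
        simp only [mul_assoc]
    _ = S := by rw [CFC.conjugate_rpow_neg_one_half T hT, mul_one, CFC.sqrt_mul_sqrt_self S]

theorem map_le_map_of_le
    (hN : ∀ U ∈ unitary 𝔄, ∀ V ∈ unitary 𝔄, ∀ X, N (U * X * V) = N X)
    {S T : 𝔄} (hS : IsStrictlyPositive S) (hST : S ≤ T) : N S ≤ N T := by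
  obtain ⟨W, hW, hW1, rfl⟩ := exists_isUnit_conj_eq_of_le hS hST
  exact map_conj_le_of_isUnit hN hW hW1 T

/-- `S` lies below a conjugate `W * T * star W` of `T` by an invertible contraction `W`.
Invertibility is required so that `W` has a polar decomposition inside the algebra. -/
def ContractiveLE (S T : 𝔄) : Prop :=
  ∃ W : 𝔄, IsUnit W ∧ ‖W‖ ≤ 1 ∧ S ≤ W * T * star W

/-- Squaring is not operator monotone, but it preserves `ContractiveLE`: the square of
`W * T * star W` is at most `W * T ^ 2 * star W`, because `star W * W ≤ 1`. -/
theorem ContractiveLE.sq {S T : 𝔄}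
    (hS : IsStrictlyPositive S) (hT : IsSelfAdjoint T) (h : ContractiveLE S T) :
    ContractiveLE (S ^ 2) (T ^ 2) := by
  have key : ∀ W T : 𝔄, IsSelfAdjoint T → ‖W‖ ≤ 1 →
      (W * T * star W) ^ 2 ≤ W * T ^ 2 * star W := by
    intro W T hT hW
    have h1 : star W * W ≤ 1 := by
      rw [← CStarAlgebra.norm_le_one_iff_of_nonneg _ (star_mul_self_nonneg W),
        CStarRing.norm_star_mul_self]
      nlinarith [norm_nonneg W]
    have h2 := star_right_conjugate_le_conjugate h1 (W * T)
    rw [star_mul, hT.star_eq] at h2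
    calc _ = W * T * (star W * W) * (T * star W) := by rw [pow_two]; simp only [mul_assoc]
      _ ≤ _ := h2
      _ = _ := by rw [pow_two]; simp only [mul_assoc, one_mul]
  obtain ⟨W, hW, hW1, hle⟩ := h
  obtain ⟨V, hV, hV1, hVS⟩ := exists_isUnit_conj_eq_of_le hS hle
  refine ⟨V * W, hV.mul hW, (norm_mul_le V W).trans (mul_le_one₀ hV1 (norm_nonneg W) hW1), ?_⟩
  have hR : IsSelfAdjoint (W * T * star W) := hT.conjugate W
  calc S ^ 2 = (V * (W * T * star W) * star V) ^ 2 := by rw [hVS]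
    _ ≤ V * (W * T * star W) ^ 2 * star V := key V _ hR hV1
    _ ≤ V * (W * T ^ 2 * star W) * star V := star_right_conjugate_le_conjugate (key W T hT hW1) V
    _ = _ := by rw [star_mul]; simp only [mul_assoc]

theorem ContractiveLE.pow_two_pow {S T : 𝔄}
    (hS : IsStrictlyPositive S) (hT : IsSelfAdjoint T) (h : ContractiveLE S T) (k : ℕ) :
    ContractiveLE (S ^ 2 ^ k) (T ^ 2 ^ k) := by
  induction k with
  | zero => simpa using h
  | succ k ih =>
    rw [pow_succ, pow_mul, pow_mul]
    exact ih.sq ⟨CStarAlgebra.pow_nonneg hS.nonneg _, hS.isUnit.pow _⟩ (hT.pow _)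

theorem ContractiveLE.map_le_map
    (hN : ∀ U ∈ unitary 𝔄, ∀ V ∈ unitary 𝔄, ∀ X, N (U * X * V) = N X)
    {S T : 𝔄} (hS : IsStrictlyPositive S) (h : ContractiveLE S T) : N S ≤ N T := by
  obtain ⟨W, hW, hW1, hle⟩ := h
  exact (map_le_map_of_le hN hS hle).trans (map_conj_le_of_isUnit hN hW hW1 T)

theorem isStrictlyPositive_exp {L : 𝔄} (hL : IsSelfAdjoint L) :
    IsStrictlyPositive (NormedSpace.exp L) :=
  ⟨hL.exp_nonneg, let _ : NormedAlgebra ℚ 𝔄 := .restrictScalars ℚ ℝ 𝔄; NormedSpace.isUnit_exp L⟩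

theorem one_add_le_exp {Z : 𝔄} (hZ : IsSelfAdjoint Z) :
    1 + Z ≤ NormedSpace.exp Z := by
  have h : 1 + Z = cfc (fun x : ℝ ↦ 1 + x) Z := by
    rw [cfc_const_add .., cfc_id' ℝ Z, map_one]
  rw [h, ← CFC.real_exp_eq_normedSpace_exp hZ]
  exact cfc_mono fun x _ ↦ by linarith [Real.add_one_le_exp x]

theorem exp_le_one_add_add {L : 𝔄} (hL : IsSelfAdjoint L)
    (hL1 : ‖L‖ ≤ 1) : NormedSpace.exp L ≤ 1 + (L + (‖L‖ ^ 2) • (1 : 𝔄)) := by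
  nontriviality 𝔄
  have h : 1 + (L + (‖L‖ ^ 2) • (1 : 𝔄)) = cfc (fun x : ℝ ↦ 1 + (x + ‖L‖ ^ 2)) L := by
    rw [cfc_const_add .., cfc_add_const .., cfc_id' ℝ L, map_one, Algebra.algebraMap_eq_smul_one]
  rw [h, ← CFC.real_exp_eq_normedSpace_exp hL]
  refine cfc_mono fun x hx ↦ ?_
  have hx1 : |x| ≤ ‖L‖ := spectrum.norm_le_norm_of_mem hx
  have h1 := (abs_le.1 (Real.abs_exp_sub_one_sub_id_le (hx1.trans hL1))).2
  have h2 : x ^ 2 ≤ ‖L‖ ^ 2 := sq_le_sq.2 (by rwa [abs_norm])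
  linarith

/-- The exponential is not operator monotone, but its composition with a unitarily invariant
seminorm is monotone on self-adjoint elements. -/
theorem map_exp_le_map_exp
    (hN : ∀ U ∈ unitary 𝔄, ∀ V ∈ unitary 𝔄, ∀ X, N (U * X * V) = N X)
    {L Z : 𝔄} (hL : IsSelfAdjoint L) (hZ : IsSelfAdjoint Z) (hLZ : L ≤ Z) :
    N (NormedSpace.exp L) ≤ N (NormedSpace.exp Z) := by
  -- for `r = 2 ^ (-k)` the quadratic error in `exp (r L) ≤ 1 + r L + ‖r L‖²` is absorbed into
  -- `exp`; after the `2 ^ k`-th power it costs the factor `exp (‖L‖² r)`, which tends to `1`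
  have key : ∀ k : ℕ, ‖L‖ ≤ 2 ^ k →
      N (NormedSpace.exp L) ≤ Real.exp (‖L‖ ^ 2 * (1 / 2) ^ k) * N (NormedSpace.exp Z) := by
    intro k hk
    let _ : NormedAlgebra ℚ 𝔄 := .restrictScalars ℚ ℝ 𝔄
    set r : ℝ := (1 / 2) ^ k with hr
    have hr0 : 0 < r := by positivity
    have hkr : (2 : ℝ) ^ k * r = 1 := by rw [hr, ← mul_pow]; norm_num
    have hrn : ‖r • L‖ = r * ‖L‖ := by rw [norm_smul, Real.norm_of_nonneg hr0.le]
    have hrL : IsSelfAdjoint (r • L) := (IsSelfAdjoint.all r).smul hL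
    set D : 𝔄 := r • Z + (‖r • L‖ ^ 2) • (1 : 𝔄) with hD
    have hDsa : IsSelfAdjoint D :=
      ((IsSelfAdjoint.all r).smul hZ).add ((IsSelfAdjoint.all _).smul (.one 𝔄))
    have h1 : NormedSpace.exp (r • L) ≤ NormedSpace.exp D := by
      refine (exp_le_one_add_add hrL ?_).trans (le_trans ?_ (one_add_le_exp hDsa))
      · rw [hrn, ← hkr, mul_comm]
        gcongr
      · rw [hD]
        gcongr
    have h2 : ContractiveLE (NormedSpace.exp (r • L)) (NormedSpace.exp D) :=
      ⟨1, isUnit_one, (CStarAlgebra.norm_le_one_iff_of_nonneg 1 zero_le_one).2 le_rfl,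
        by simpa using h1⟩
    have h3 := h2.pow_two_pow (isStrictlyPositive_exp hrL)
      (isStrictlyPositive_exp hDsa).isSelfAdjoint k
    have h4 : NormedSpace.exp (r • L) ^ 2 ^ k = NormedSpace.exp L := by
      rw [← NormedSpace.exp_nsmul, ← Nat.cast_smul_eq_nsmul ℝ, smul_smul]
      simp [hkr]
    have h5 : NormedSpace.exp D ^ 2 ^ k = Real.exp (‖L‖ ^ 2 * r) • NormedSpace.exp Z := by
      rw [← NormedSpace.exp_nsmul, ← Nat.cast_smul_eq_nsmul ℝ, hD, smul_add, smul_smul, smul_smul,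
        exp_add_smul_one]
      push_cast
      rw [hkr, one_smul, hrn]
      congr 2
      linear_combination ‖L‖ ^ 2 * r * hkr
    rw [h4, h5] at h3
    refine (h3.map_le_map hN (isStrictlyPositive_exp hL)).trans_eq ?_
    rw [map_real_smul_of_nonneg N (Real.exp_nonneg _)]
  have hlim : Filter.Tendsto
      (fun k : ℕ ↦ Real.exp (‖L‖ ^ 2 * (1 / 2) ^ k) * N (NormedSpace.exp Z)) Filter.atTop
      (nhds (Real.exp (‖L‖ ^ 2 * 0) * N (NormedSpace.exp Z))) := by
    refine ((Real.continuous_exp.tendsto _).comp (Filter.Tendsto.const_mul _ ?_)).mul_const _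
    exact tendsto_pow_atTop_nhds_zero_of_lt_one (by norm_num) (by norm_num)
  rw [mul_zero, Real.exp_zero, one_mul] at hlim
  refine ge_of_tendsto hlim ?_
  filter_upwards [(tendsto_pow_atTop_atTop_of_one_lt (one_lt_two (α := ℝ))).eventually_ge_atTop ‖L‖]
    with k hk using key k hk

end Seminorm

/-! ### Weighted means in a C⋆-algebra -/

section Mean

theorem arithMean_one_eq_cfc {𝔄 : Type*} [CStarAlgebra 𝔄] {T : 𝔄} (hT : IsSelfAdjoint T) (v : ℝ) :
    arithMean v 1 T = cfc (fun x : ℝ ↦ (1 - v) + v * x) T := by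
  rw [cfc_const_add .., cfc_const_mul_id v T, Algebra.algebraMap_eq_smul_one, arithMean]

/-- The weighted geometric mean of two strictly positive elements of a C⋆-algebra, for any real
weight `v`; for bounded operators it is `opGeomMean`. -/
noncomputable def cstarGeomMean {𝔄 : Type*} [CStarAlgebra 𝔄] [PartialOrder 𝔄] [StarOrderedRing 𝔄]
    (v : ℝ) (A B : 𝔄) : 𝔄 :=
  A ^ (1 / 2 : ℝ) * (A ^ (-(1 / 2) : ℝ) * B * A ^ (-(1 / 2) : ℝ)) ^ v * A ^ (1 / 2 : ℝ)

variable {𝔄 : Type*} [CStarAlgebra 𝔄] [PartialOrder 𝔄] [StarOrderedRing 𝔄] {A B : 𝔄} {v : ℝ}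

theorem rpow_half_mul_rpow_half (hA : IsStrictlyPositive A) :
    A ^ (1 / 2 : ℝ) * A ^ (1 / 2 : ℝ) = A := by
  rw [← CFC.rpow_add hA.isUnit, add_halves, CFC.rpow_one A hA.nonneg]

theorem rpow_half_conj_conj (hA : IsStrictlyPositive A) (B : 𝔄) :
    A ^ (1 / 2 : ℝ) * (A ^ (-(1 / 2) : ℝ) * B * A ^ (-(1 / 2) : ℝ)) * A ^ (1 / 2 : ℝ) = B := by
  calc _ = (A ^ (1 / 2 : ℝ) * A ^ (-(1 / 2) : ℝ)) * B * (A ^ (-(1 / 2) : ℝ) * A ^ (1 / 2 : ℝ)) := by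
        simp only [mul_assoc]
    _ = B := by rw [CFC.rpow_mul_rpow_neg _ hA, CFC.rpow_neg_mul_rpow _ hA, one_mul, mul_one]

/-- Congruence by `A ^ (1/2)` reduces the arithmetic mean to the case where the first argument
is `1`. -/
theorem arithMean_eq_conj (hA : IsStrictlyPositive A) (B : 𝔄) (v : ℝ) :
    arithMean v A B = A ^ (1 / 2 : ℝ) *
      arithMean v 1 (A ^ (-(1 / 2) : ℝ) * B * A ^ (-(1 / 2) : ℝ)) * A ^ (1 / 2 : ℝ) := by
  simp only [arithMean]
  rw [mul_add, add_mul, mul_smul_comm, smul_mul_assoc, mul_smul_comm, smul_mul_assoc, mul_one,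
    rpow_half_mul_rpow_half hA, rpow_half_conj_conj hA]

theorem one_le_rpow_neg_half_conj (hA : IsStrictlyPositive A) (hAB : A ≤ B) :
    1 ≤ A ^ (-(1 / 2) : ℝ) * B * A ^ (-(1 / 2) : ℝ) := by
  rw [← CFC.conjugate_rpow_neg_one_half A hA]
  exact conjugate_le_conjugate_of_nonneg hAB CFC.rpow_nonneg

theorem le_arithMean (hv : 1 ≤ v) (hAB : A ≤ B) : B ≤ arithMean v A B := by
  have h : arithMean v A B = B + (v - 1) • (B - A) := by
    simp only [arithMean]
    module
  rw [h]
  exact le_add_of_nonneg_right (smul_nonneg (by linarith) (sub_nonneg.2 hAB))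

theorem arithMean_le_cstarGeomMean (hv : 1 ≤ v) (hA : IsStrictlyPositive A) (hB : 0 ≤ B) :
    arithMean v A B ≤ cstarGeomMean v A B := by
  have hT : 0 ≤ A ^ (-(1 / 2) : ℝ) * B * A ^ (-(1 / 2) : ℝ) :=
    conjugate_nonneg_of_nonneg hB CFC.rpow_nonneg
  rw [arithMean_eq_conj hA, cstarGeomMean]
  refine conjugate_le_conjugate_of_nonneg ?_ CFC.rpow_nonneg
  rw [arithMean_one_eq_cfc (.of_nonneg hT), CFC.rpow_eq_cfc_real hT]
  have hc : ContinuousOn (fun x : ℝ ↦ x ^ v)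
      (spectrum ℝ (A ^ (-(1 / 2) : ℝ) * B * A ^ (-(1 / 2) : ℝ))) :=
    (Real.continuous_rpow_const (by linarith)).continuousOn
  refine cfc_mono (fun x hx ↦ one_sub_add_mul_le_rpow hv (spectrum_nonneg_of_nonneg hT hx))
    (by fun_prop) hc

/-- The element `A ^ (-1/2) * B * A ^ (-1/2)` has its spectrum in `[1, M / m]`, where the quotient
of the scalar means is largest at `M / m`. -/
theorem cstarGeomMean_le_smul_arithMean {m M : ℝ} (hv : 1 ≤ v) (hm : 0 < m)
    (hmA : m • (1 : 𝔄) ≤ A) (hA : IsStrictlyPositive A) (hAB : A ≤ B) (hmM : m ≤ M)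
    (hBM : B ≤ M • (1 : 𝔄)) :
    cstarGeomMean v A B ≤ (scalarGeomMean v m M / arithMean v m M) • arithMean v A B := by
  have hh : 1 ≤ M / m := (one_le_div hm).2 hmM
  have hT1 := one_le_rpow_neg_half_conj hA hAB
  have hTh : A ^ (-(1 / 2) : ℝ) * B * A ^ (-(1 / 2) : ℝ) ≤ algebraMap ℝ 𝔄 (M / m) := by
    have hBA : B ≤ (M / m) • A := by
      refine hBM.trans ?_
      have h := smul_le_smul_of_nonneg_left hmA (zero_le_one.trans hh)
      rwa [smul_smul, div_mul_cancel₀ _ hm.ne'] at h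
    refine (conjugate_le_conjugate_of_nonneg hBA CFC.rpow_nonneg).trans_eq ?_
    rw [mul_smul_comm, smul_mul_assoc, CFC.conjugate_rpow_neg_one_half A hA,
      Algebra.algebraMap_eq_smul_one]
  rw [arithMean_eq_conj hA, cstarGeomMean, ← smul_mul_assoc, ← mul_smul_comm]
  refine conjugate_le_conjugate_of_nonneg ?_ CFC.rpow_nonneg
  set T := A ^ (-(1 / 2) : ℝ) * B * A ^ (-(1 / 2) : ℝ)
  have hT : 0 ≤ T := zero_le_one.trans hT1
  rw [arithMean_one_eq_cfc (.of_nonneg hT), CFC.rpow_eq_cfc_real hT, ← cfc_const_mul ..]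
  have hc : ContinuousOn (fun x : ℝ ↦ x ^ v) (spectrum ℝ T) :=
    (Real.continuous_rpow_const (by linarith)).continuousOn
  refine cfc_mono (fun x hx ↦ ?_) hc (by fun_prop)
  have hx1 : 1 ≤ x := by
    rw [← map_one (algebraMap ℝ 𝔄)] at hT1
    exact (algebraMap_le_iff_le_spectrum (.of_nonneg hT)).1 hT1 x hx
  have hxh : x ≤ M / m := (le_algebraMap_iff_spectrum_le (.of_nonneg hT)).1 hTh x hx
  rw [scalarGeomMean_div_arithMean hm (hm.trans_le hmM), div_mul_eq_mul_div, le_div_iff₀]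
  · exact rpow_mul_le_rpow_mul hv hx1 hxh
  · nlinarith

theorem isStrictlyPositive_of_smul_one_le {m : ℝ} (hm : 0 < m) (h : m • (1 : 𝔄) ≤ A) :
    IsStrictlyPositive A := by
  refine IsStrictlyPositive.of_le ⟨smul_nonneg hm.le zero_le_one, ?_⟩ h
  rw [← Algebra.algebraMap_eq_smul_one]
  exact (isUnit_iff_ne_zero.2 hm.ne').map _

theorem smul_one_le_cfc {f : ℝ → ℝ} (hf : ContinuousOn f (Set.Ioi 0))
    (hf' : MonotoneOn f (Set.Ioi 0)) {m : ℝ} (hA : IsStrictlyPositive A) (hm : 0 < m) (h : m • (1 : 𝔄) ≤ A) :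
    f m • (1 : 𝔄) ≤ cfc f A := by
  have hA0 : ∀ x ∈ spectrum ℝ A, 0 < x := fun x hx ↦ hA.spectrum_pos hx
  rw [← Algebra.algebraMap_eq_smul_one] at h ⊢
  refine algebraMap_le_cfc f _ A (fun x hx ↦ hf' hm (hA0 x hx) ?_) (hf.mono hA0) hA.isSelfAdjoint
  exact (algebraMap_le_iff_le_spectrum hA.isSelfAdjoint).1 h x hx

theorem cfc_le_smul_one {f : ℝ → ℝ} (hf : ContinuousOn f (Set.Ioi 0))
    (hf' : MonotoneOn f (Set.Ioi 0)) {m : ℝ} (hA : IsStrictlyPositive A) (hm : 0 < m) (h : A ≤ m • (1 : 𝔄)) :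
    cfc f A ≤ f m • (1 : 𝔄) := by
  have hA0 : ∀ x ∈ spectrum ℝ A, 0 < x := fun x hx ↦ hA.spectrum_pos hx
  rw [← Algebra.algebraMap_eq_smul_one] at h ⊢
  refine cfc_le_algebraMap f _ A (fun x hx ↦ hf' (hA0 x hx) hm ?_) (hf.mono hA0) hA.isSelfAdjoint
  exact (le_algebraMap_iff_spectrum_le hA.isSelfAdjoint).1 h x hx

/-- For `1 ≤ v` the arithmetic mean extrapolates beyond `B`, and `B` is the convex combination of
`A` and `arithMean v A B` with weights `1 - 1 / v` and `1 / v`; so concavity bounds the value at the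
extrapolated point from above. -/
theorem le_arithMean_of_concaveOn {s : Set 𝔄} {g : 𝔄 → 𝔄} (hg : ConcaveOn ℝ s g)
    (hv : 1 ≤ v) (hA : A ∈ s) (hX : arithMean v A B ∈ s) :
    g (arithMean v A B) ≤ arithMean v (g A) (g B) := by
  have hv0 : 0 < v := by linarith
  have hw : (1 - v⁻¹) + v⁻¹ = 1 := by ring
  have h := hg.2 hA hX (sub_nonneg.2 (inv_le_one_of_one_le₀ hv))
    (by positivity) hw
  have hB : (1 - v⁻¹) • A + v⁻¹ • arithMean v A B = B := by
    simp only [arithMean, smul_add, smul_smul]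
    rw [inv_mul_cancel₀ hv0.ne', mul_sub, inv_mul_cancel₀ hv0.ne']
    module
  rw [hB] at h
  have h2 := smul_le_smul_of_nonneg_left h hv0.le
  rw [smul_add, smul_smul, smul_smul, mul_inv_cancel₀ hv0.ne', one_smul, mul_sub,
    mul_inv_cancel₀ hv0.ne', mul_one] at h2
  rw [← sub_nonneg] at h2 ⊢
  refine h2.trans_eq ?_
  simp only [arithMean]
  module

/-! ### Ando-Hiai and Golden-Thompson inequalities in a C⋆-algebra -/

variable {N : Seminorm ℂ 𝔄}

/-- Since `S ≤ N S • 1`, one has `S ^ p ≤ N S ^ (p - 1) • S`. -/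
theorem map_rpow_le
    (hN : ∀ U ∈ unitary 𝔄, ∀ V ∈ unitary 𝔄, ∀ X, N (U * X * V) = N X)
    (hN1 : ∀ S : 𝔄, 0 ≤ S → S ≤ N S • (1 : 𝔄))
    {S : 𝔄} (hS : IsStrictlyPositive S) {p : ℝ} (hp : 1 < p) : N (S ^ p) ≤ N S ^ p := by
  have hle : S ^ p ≤ (N S ^ (p - 1)) • S := by
    rw [CFC.rpow_eq_cfc_real hS.nonneg]
    nth_rw 3 [← cfc_id' ℝ S hS.isSelfAdjoint]
    rw [← cfc_smul ..]
    have hc : ContinuousOn (fun x : ℝ ↦ x ^ p) (spectrum ℝ S) :=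
      (Real.continuous_rpow_const (by linarith)).continuousOn
    refine cfc_mono (fun x hx ↦ ?_) hc (by fun_prop)
    have hx0 : 0 < x := hS.spectrum_pos hx
    have hSN := hN1 S hS.nonneg
    rw [← Algebra.algebraMap_eq_smul_one] at hSN
    have hxN : x ≤ N S := (le_algebraMap_iff_spectrum_le hS.isSelfAdjoint).1 hSN x hx
    rw [smul_eq_mul]
    calc x ^ p = x ^ (p - 1) * x := by rw [Real.rpow_sub_one hx0.ne', div_mul_cancel₀ _ hx0.ne']
      _ ≤ _ := by
        have : 0 ≤ p - 1 := by linarith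
        gcongr
  have hN0 : 0 ≤ N S := apply_nonneg N S
  calc N (S ^ p) ≤ N ((N S ^ (p - 1)) • S) := map_le_map_of_le hN (hS.rpow _ p) hle
    _ = N S ^ (p - 1) * N S := map_real_smul_of_nonneg N (by positivity) S
    _ = N S ^ p := by
      rw [← Real.rpow_add_one' hN0 (by linarith), sub_add_cancel]

theorem arithMean_rpow_rpow_inv_le (hv : 1 ≤ v) {p : ℝ} (hp : 1 < p) (hA : IsStrictlyPositive A)
    (hB : IsStrictlyPositive B) (hX : 0 ≤ arithMean v (A ^ p) (B ^ p)) :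
    arithMean v (A ^ p) (B ^ p) ^ p⁻¹ ≤ arithMean v A B := by
  have hp0 : p ≠ 0 := by linarith
  have h := le_arithMean_of_concaveOn
    (CFC.concaveOn_rpow ⟨by positivity, inv_le_one_of_one_le₀ hp.le⟩) hv
    (Set.mem_Ici.2 (CFC.rpow_nonneg (a := A) (y := p))) (Set.mem_Ici.2 hX)
  simpa only [CFC.rpow_rpow_inv _ p hp0 hA, CFC.rpow_rpow_inv _ p hp0 hB] using h

/-- The Ando-Hiai inequality for seminorms that dominate the numerical radius of positive elements.
The separation `A ≤ m' ≤ B` is what ensures `A ^ p ≤ B ^ p`. -/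
theorem map_cstarGeomMean_rpow_le
    (hN : ∀ U ∈ unitary 𝔄, ∀ V ∈ unitary 𝔄, ∀ X, N (U * X * V) = N X)
    (hN1 : ∀ S : 𝔄, 0 ≤ S → S ≤ N S • (1 : 𝔄))
    {m m' M : ℝ} (hm : 0 < m) (hm' : 0 < m') (hmM : m ≤ M) (hmA : m • (1 : 𝔄) ≤ A)
    (hA' : A ≤ m' • (1 : 𝔄)) (hB' : m' • (1 : 𝔄) ≤ B)
    (hBM : B ≤ M • (1 : 𝔄)) (hv : 1 ≤ v) {p : ℝ} (hp : 1 < p) :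
    N (cstarGeomMean v (A ^ p) (B ^ p)) ≤
      scalarGeomMean v (m ^ p) (M ^ p) / arithMean v (m ^ p) (M ^ p) *
        N (cstarGeomMean v A B) ^ p := by
  have hp0 : 0 < p := by linarith
  have hM : 0 < M := hm.trans_le hmM
  have hA := isStrictlyPositive_of_smul_one_le hm hmA
  have hB := isStrictlyPositive_of_smul_one_le hm' hB'
  have hc : ContinuousOn (fun x : ℝ ↦ x ^ p) (Set.Ioi 0) :=
    (Real.continuous_rpow_const hp0.le).continuousOn
  have hmono : MonotoneOn (fun x : ℝ ↦ x ^ p) (Set.Ioi 0) := fun x hx y _ hxy ↦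
    Real.rpow_le_rpow (le_of_lt hx) hxy hp0.le
  have hAcfc := CFC.rpow_eq_cfc_real (y := p) hA.nonneg
  have hBcfc := CFC.rpow_eq_cfc_real (y := p) hB.nonneg
  have hmAp : m ^ p • (1 : 𝔄) ≤ A ^ p := hAcfc ▸ smul_one_le_cfc hc hmono hA hm hmA
  have hABp : A ^ p ≤ B ^ p := by
    rw [hAcfc, hBcfc]
    exact (cfc_le_smul_one hc hmono hA hm' hA').trans (smul_one_le_cfc hc hmono hB hm' hB')
  have hBMp : B ^ p ≤ M ^ p • (1 : 𝔄) := hBcfc ▸ cfc_le_smul_one hc hmono hB hM hBM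
  have hmMp : m ^ p ≤ M ^ p := Real.rpow_le_rpow hm.le hmM hp0.le
  have hmp : 0 < m ^ p := Real.rpow_pos_of_pos hm p
  have hAp : IsStrictlyPositive (A ^ p) := hA.rpow _ _
  have hBp : IsStrictlyPositive (B ^ p) := hB.rpow _ _
  set C := scalarGeomMean v (m ^ p) (M ^ p) / arithMean v (m ^ p) (M ^ p)
  have hC : 0 < C := scalarGeomMean_div_arithMean_pos hv hmp hmMp
  set X := arithMean v (A ^ p) (B ^ p)
  have hX : IsStrictlyPositive X := hBp.of_le (le_arithMean hv hABp)
  have hG : IsStrictlyPositive (cstarGeomMean v (A ^ p) (B ^ p)) :=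
    hX.of_le (arithMean_le_cstarGeomMean hv hAp hBp.nonneg)
  have hS : IsStrictlyPositive (X ^ p⁻¹) := hX.rpow _ _
  calc N (cstarGeomMean v (A ^ p) (B ^ p)) ≤ N (C • X) :=
        map_le_map_of_le hN hG (cstarGeomMean_le_smul_arithMean hv hmp hmAp hAp hABp hmMp hBMp)
    _ = C * N X := map_real_smul_of_nonneg N hC.le X
    _ = C * N ((X ^ p⁻¹) ^ p) := by rw [CFC.rpow_inv_rpow X p hp0.ne' hX]
    _ ≤ C * N (X ^ p⁻¹) ^ p := by
      gcongr
      exact map_rpow_le hN hN1 hS hp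
    _ ≤ C * N (cstarGeomMean v A B) ^ p := by
      gcongr
      refine map_le_map_of_le hN hS ?_
      exact (arithMean_rpow_rpow_inv_le hv hp hA hB hX.nonneg).trans
        (arithMean_le_cstarGeomMean hv hA hB.nonneg)

theorem rpow_eq_exp_smul_log {S : 𝔄} (hS : IsStrictlyPositive S) (r : ℝ) :
    S ^ r = NormedSpace.exp (r • CFC.log S) := by
  have hpos : ∀ x ∈ spectrum ℝ S, 0 < x := fun x hx ↦ hS.spectrum_pos hx
  have hlog : ContinuousOn Real.log (spectrum ℝ S) :=
    Real.continuousOn_log.mono fun x hx ↦ (hpos x hx).ne'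
  rw [← CFC.real_exp_eq_normedSpace_exp ((IsSelfAdjoint.all r).smul .log), CFC.log,
    ← cfc_const_mul r _ S hlog, ← cfc_comp' Real.exp _ S (by fun_prop) (by fun_prop)
    hS.isSelfAdjoint, CFC.rpow_eq_cfc_real hS.nonneg]
  refine cfc_congr fun x hx ↦ ?_
  rw [Real.rpow_def_of_pos (hpos x hx), mul_comm]

/-- The Golden-Thompson inequality in a C⋆-algebra. The separation `A ≤ m' ≤ B` is what ensures
`exp (p • A) ≤ exp (p • B)`. -/
theorem map_cstarGeomMean_exp_rpow_le
    (hN : ∀ U ∈ unitary 𝔄, ∀ V ∈ unitary 𝔄, ∀ X, N (U * X * V) = N X)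
    {m m' M : ℝ} (hm : 0 < m) (hm' : 0 < m') (hmM : m ≤ M) (hmA : m • (1 : 𝔄) ≤ A)
    (hA' : A ≤ m' • (1 : 𝔄)) (hB' : m' • (1 : 𝔄) ≤ B)
    (hBM : B ≤ M • (1 : 𝔄)) (hv : 1 ≤ v) {p : ℝ} (hp : 0 < p) :
    N (cstarGeomMean v (NormedSpace.exp (p • A)) (NormedSpace.exp (p • B)) ^ (1 / p)) ≤
      (scalarGeomMean v (Real.exp (p * m)) (Real.exp (p * M)) /
          arithMean v (Real.exp (p * m)) (Real.exp (p * M))) ^ (1 / p) *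
        N (NormedSpace.exp (arithMean v A B)) := by
  have hM : 0 < M := hm.trans_le hmM
  have hA := isStrictlyPositive_of_smul_one_le hm hmA
  have hB := isStrictlyPositive_of_smul_one_le hm' hB'
  have hc : ContinuousOn (fun x : ℝ ↦ Real.exp (p * x)) (Set.Ioi 0) := by fun_prop
  have hmono : MonotoneOn (fun x : ℝ ↦ Real.exp (p * x)) (Set.Ioi 0) := fun x _ y _ hxy ↦
    Real.exp_le_exp.2 (by gcongr)
  have hcfc : ∀ {Z : 𝔄}, IsSelfAdjoint Z →
      NormedSpace.exp (p • Z) = cfc (fun x : ℝ ↦ Real.exp (p * x)) Z := by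
    intro Z hZ
    rw [cfc_comp_const_mul p Real.exp Z (by fun_prop) hZ,
      CFC.real_exp_eq_normedSpace_exp ((IsSelfAdjoint.all p).smul hZ)]
  have hAsa : IsSelfAdjoint (p • A) := (IsSelfAdjoint.all p).smul hA.isSelfAdjoint
  have hBsa : IsSelfAdjoint (p • B) := (IsSelfAdjoint.all p).smul hB.isSelfAdjoint
  have hmAp : Real.exp (p * m) • (1 : 𝔄) ≤ NormedSpace.exp (p • A) := by
    rw [hcfc hA.isSelfAdjoint]
    exact smul_one_le_cfc hc hmono hA hm hmA
  have hABp : NormedSpace.exp (p • A) ≤ NormedSpace.exp (p • B) := by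
    rw [hcfc hA.isSelfAdjoint, hcfc hB.isSelfAdjoint]
    exact (cfc_le_smul_one hc hmono hA hm' hA').trans (smul_one_le_cfc hc hmono hB hm' hB')
  have hBMp : NormedSpace.exp (p • B) ≤ Real.exp (p * M) • (1 : 𝔄) := by
    rw [hcfc hB.isSelfAdjoint]
    exact cfc_le_smul_one hc hmono hB hM hBM
  have hmMp : Real.exp (p * m) ≤ Real.exp (p * M) := hmono hm hM hmM
  have hEA := isStrictlyPositive_exp hAsa
  have hEB := isStrictlyPositive_exp hBsa
  set C := scalarGeomMean v (Real.exp (p * m)) (Real.exp (p * M)) /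
    arithMean v (Real.exp (p * m)) (Real.exp (p * M))
  have hC : 0 < C := scalarGeomMean_div_arithMean_pos hv (Real.exp_pos _) hmMp
  set X := arithMean v (NormedSpace.exp (p • A)) (NormedSpace.exp (p • B))
  set G := cstarGeomMean v (NormedSpace.exp (p • A)) (NormedSpace.exp (p • B))
  have hX : IsStrictlyPositive X := hEB.of_le (le_arithMean hv hABp)
  have hG : IsStrictlyPositive G := hX.of_le (arithMean_le_cstarGeomMean hv hEA hEB.nonneg)
  have hlogX : CFC.log X ≤ p • arithMean v A B := by
    have h := le_arithMean_of_concaveOn CFC.concaveOn_log hv hEA hX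
    rw [CFC.log_exp _ hAsa, CFC.log_exp _ hBsa] at h
    refine h.trans_eq ?_
    simp only [arithMean]
    module
  have hlogG : (1 / p) • CFC.log G ≤ arithMean v A B + (1 / p * Real.log C) • (1 : 𝔄) := by
    have h : CFC.log G ≤ Real.log C • (1 : 𝔄) + CFC.log X := by
      rw [← Algebra.algebraMap_eq_smul_one, ← CFC.log_smul' X hC hX]
      exact CFC.log_le_log
        (cstarGeomMean_le_smul_arithMean hv (Real.exp_pos _) hmAp hEA hABp hmMp hBMp) hG
    have h2 := smul_le_smul_of_nonneg_left (h.trans (add_le_add_right hlogX _))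
      (one_div_pos.2 hp).le
    refine h2.trans_eq ?_
    rw [smul_add, smul_smul, smul_smul, one_div_mul_cancel hp.ne', one_smul, add_comm]
  have hYsa : IsSelfAdjoint (arithMean v A B) :=
    ((IsSelfAdjoint.all _).smul hA.isSelfAdjoint).add ((IsSelfAdjoint.all _).smul hB.isSelfAdjoint)
  rw [rpow_eq_exp_smul_log hG]
  refine (map_exp_le_map_exp hN ((IsSelfAdjoint.all _).smul .log)
    (hYsa.add ((IsSelfAdjoint.all _).smul (.one _))) hlogG).trans_eq ?_
  rw [exp_add_smul_one, map_real_smul_of_nonneg N (Real.exp_nonneg _), Real.rpow_def_of_pos hC,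
    mul_comm (1 / p)]

end Mean

/-! ### Operators on a Hilbert space -/

section RankOne

variable {H : Type*} [NormedAddCommGroup H] [InnerProductSpace ℂ H] [CompleteSpace H]
  {N : Seminorm ℂ (H →L[ℂ] H)}

/-- For a unit vector `x` with projection `P` one has `P S P = ⟪x, S x⟫ P`, so
`⟪x, S x⟫ ≤ N (P S P) ≤ N S`. -/
theorem le_map_smul_one
    (hN : ∀ U ∈ unitary (H →L[ℂ] H), ∀ V ∈ unitary (H →L[ℂ] H), ∀ X, N (U * X * V) = N X)
    (hN1 : ∀ x : H, ‖x‖ = 1 → 1 ≤ N (InnerProductSpace.rankOne ℂ x x))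
    {S : H →L[ℂ] H} (hS : 0 ≤ S) : S ≤ N S • (1 : H →L[ℂ] H) := by
  have hSsa : IsSelfAdjoint S := .of_nonneg hS
  have hunit : ∀ x : H, ‖x‖ = 1 → ‖inner ℂ x (S x)‖ ≤ N S := by
    intro x hx
    set P := InnerProductSpace.rankOne ℂ x x with hP
    have hPp : IsStarProjection P := InnerProductSpace.isStarProjection_rankOne_self hx
    have hPSP : P * S * P = inner ℂ x (S x) • P := by
      ext y
      simp [hP, smul_smul, mul_comm]
    have h := map_conj_le_of_isSelfAdjoint hN hPp.isSelfAdjoint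
      (by rw [hP, InnerProductSpace.norm_rankOne, hx, one_mul]) S
    rw [hPSP, map_smul_eq_mul] at h
    exact (le_mul_of_one_le_right (norm_nonneg _) (hN1 x hx)).trans h
  rw [ContinuousLinearMap.le_def, ContinuousLinearMap.isPositive_def']
  have hsa : IsSelfAdjoint (N S • (1 : H →L[ℂ] H) - S) :=
    ((IsSelfAdjoint.all (N S)).smul (.one _)).sub hSsa
  refine ⟨hsa, fun x ↦ ?_⟩
  have hx : ‖inner ℂ x (S x)‖ ≤ N S * ‖x‖ ^ 2 := by
    rcases eq_or_ne x 0 with rfl | hx0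
    · simp
    have h := hunit ((‖x‖⁻¹ : ℂ) • x) (by simp [norm_smul, hx0])
    rw [map_smul, inner_smul_left, inner_smul_right, norm_mul, norm_mul] at h
    have hxpos : 0 < ‖x‖ := norm_pos_iff.2 hx0
    simp only [RCLike.norm_conj, norm_inv, Complex.norm_real, norm_norm] at h
    rw [← mul_assoc, ← mul_inv, inv_mul_le_iff₀ (by positivity)] at h
    linarith
  have hx' := (RCLike.re_le_norm (inner ℂ x (S x))).trans hx
  rw [ContinuousLinearMap.reApplyInnerSelf_apply, inner_re_symm]
  simp only [sub_apply, smul_apply, one_apply_eq_self, inner_sub_right, map_sub]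
  rw [← Complex.coe_smul, inner_smul_right, inner_self_eq_norm_sq_to_K]
  norm_cast
  refine sub_nonneg.2 (hx'.trans_eq ?_)
  simp [-Complex.ofReal_pow]

end RankOne

theorem mainTheorem1 {H : Type*} [NormedAddCommGroup H] [InnerProductSpace ℂ H] [CompleteSpace H]
    (N : Seminorm ℂ (H →L[ℂ] H)) (hN : IsUnitarilyInvariantNorm N)
    (A B : H →L[ℂ] H) (m₁ m₂ M₁ M₂ v : ℝ)
    (hm₂ : 0 < m₂) (hm : m₂ ≤ m₁) (hmM : m₁ < M₁) (hM : M₁ ≤ M₂)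
    (hA₂ : m₂ • (1 : H →L[ℂ] H) ≤ A) (hA₁ : A ≤ m₁ • (1 : H →L[ℂ] H))
    (hB₁ : M₁ • (1 : H →L[ℂ] H) ≤ B) (hB₂ : B ≤ M₂ • (1 : H →L[ℂ] H))
    (hv : 1 ≤ v) :
    -- Ando-Hiai; the norm is at least `1` on orthogonal projections of rank one
    ((∀ x : H, ‖x‖ = 1 → 1 ≤ N (InnerProductSpace.rankOne ℂ x x)) → ∀ p : ℝ, 1 < p →
      N (opGeomMean v (A ^ p) (B ^ p)) ≤
          scalarGeomMean v (m₂ ^ p) (M₂ ^ p) / arithMean v (m₂ ^ p) (M₂ ^ p) *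
            N (opGeomMean v A B) ^ p ∧
        (N (opGeomMean v A B) ≤ 1 →
          N (opGeomMean v (A ^ p) (B ^ p)) ≤
            scalarGeomMean v (m₂ ^ p) (M₂ ^ p) / arithMean v (m₂ ^ p) (M₂ ^ p))) ∧
    -- Golden-Thompson, for operators on a finite-dimensional space
    (FiniteDimensional ℂ H → ∀ p : ℝ, 0 < p →
      N (opGeomMean v (NormedSpace.exp (p • A)) (NormedSpace.exp (p • B)) ^ (1 / p)) ≤
        (scalarGeomMean v (Real.exp (p * m₂)) (Real.exp (p * M₂)) /
            arithMean v (Real.exp (p * m₂)) (Real.exp (p * M₂))) ^ (1 / p) *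
          N (NormedSpace.exp (arithMean v A B))) := by
  have hm₁ : 0 < m₁ := hm₂.trans_le hm
  have hB₁' : m₁ • (1 : H →L[ℂ] H) ≤ B :=
    (smul_le_smul_of_nonneg_right hmM.le zero_le_one).trans hB₁
  have hmM' : m₂ ≤ M₂ := hm.trans (hmM.le.trans hM)
  refine ⟨fun hN1 p hp ↦ ?_, fun _ p hp ↦ ?_⟩
  · have h := map_cstarGeomMean_rpow_le hN.map_unitary_mul_mul
      (fun S hS ↦ le_map_smul_one hN.map_unitary_mul_mul hN1 hS) hm₂ hm₁ hmM' hA₂ hA₁ hB₁' hB₂ hv hp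
    refine ⟨h, fun h1 ↦ h.trans (mul_le_of_le_one_right ?_ ?_)⟩
    · exact (scalarGeomMean_div_arithMean_pos hv (Real.rpow_pos_of_pos hm₂ p)
        (Real.rpow_le_rpow hm₂.le hmM' (by linarith))).le
    · exact Real.rpow_le_one (apply_nonneg N _) h1 (by linarith)
  · exact map_cstarGeomMean_exp_rpow_le hN.map_unitary_mul_mul hm₂ hm₁ hmM' hA₂ hA₁ hB₁' hB₂ hv hp
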